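/- Conventions. A semigroup $S$ is inverse if every $x\in S$ has exactly one $x^{-1}$ with $xx^{-1}x=x$ and $x^{-1}xx^{-1}=x^{-1}$. A semigroup $S$ with zero $\mathbf 0$ is $0$-simple if $\{\mathbf 0\}$ is its unique proper two-sided ideal. A $0$-simple inverse $\omega$-semigroup is a $0$-simple inverse semigroup whose set of non-zero idempotents, ordered by $e\preccurlyeq f\iff ef=fe=e$, is order isomorphic to $(\omega,\geqslant)$. A topological semigroup is a topological space with a jointly continuous semigroup operation; a topological inverse semigroup is an inverse topological semigroup with continuous inversion. A maximal subgroup of $S$ is a subset that is a group under the operation of $S$ and is maximal under inclusion among such subsets. Elements $a,b$ lie in the same $\mathscr H$-class if $S^1a=S^1b$ and $aS^1=bS^1$. For a semilattice $E$, groups $G_\alpha$ $(\alpha\in E)$ and homomorphisms $\varphi_{\alpha,\beta}\colon G_\alpha\to G_\beta$ $(\beta\preccurlyeq\alpha)$ with $\varphi_{\alpha,\alpha}=\mathrm{id}$ and $\varphi_{\beta,\gamma}\circ\varphi_{\alpha,\beta}=\varphi_{\alpha,\gamma}$, the semigroup $[E;G_\alpha,\varphi_{\alpha,\beta}]$ is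 $\bigsqcup_\alpha G_\alpha$ with $a*b=\varphi_{\alpha,\alpha\beta}(a)\,\varphi_{\beta,\alpha\beta}(b)$ for $a\in G_\alpha$, $b\in G_\beta$. For a monoid $T$ and a homomorphism $\theta$ from $T$ to its group of units, $\mathbf{BR}(T,\theta)$ is $\omega\times T\times\omega$ with $$(i,s,j)(k,t,l)=\bigl(i+k-m,\ \theta^{k-m}(s)\,\theta^{j-m}(t),\ j+l-m\bigr),\qquad m=\min\{j,k\},$$ and $\mathbf{BR}^{\mathbf 0}(T,\theta)$ is $\mathbf{BR}(T,\theta)$ with an adjoined zero $\mathbf 0$. Corollary. Let $S$ be a Hausdorff topological $0$-simple inverse $\omega$-semigroup such that every maximal subgroup of $S$ is compact. Then there are a finite semilattice $E$ with greatest element, compact Hausdorff topological groups $G_\alpha$ $(\alpha\in E)$, a semigroup $T=[E;G_\alpha,\varphi_{\alpha,\beta}]$ which is a topological inverse semigroup in the topological sum topology, a homomorphism $\theta$ from $T$ to its group of units, and a topology $\tau$ on $\mathbf{BR}^{\mathbf 0}(T,\theta)$ such that: 1. $S$ is topologically isomorphic to $(\mathbf{BR}^{\mathbf 0}(T,\theta),\tau)$,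 which is a Hausdorff topological semigroup; for some $i\in\omega$ the map $t\mapsto(i,t,i)$ is a homeomorphism of $T$ onto the subspace $\{(i,t,i):t\in T\}$; and $\mathbf{BR}(T,\theta)$ with the topology induced by $\tau$ is a topological inverse semigroup; 2. every $\mathscr H$-class of $(\mathbf{BR}^{\mathbf 0}(T,\theta),\tau)$ is compact, and every $\mathscr H$-class other than $\{\mathbf 0\}$ is open; 3. if, moreover, $S$ is locally compact, then $(\mathbf{BR}^{\mathbf 0}(T,\theta),\tau)$ is a topological inverse semigroup and every $\mathscr H$-class in it, including $\{\mathbf 0\}$, is open-and-compact. -/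

import Mathlib

open Set Topology

universe u v

section AlgebraicNotions

/-- `y` is an inverse of `x`: `x y x = x` and `y x y = y`. -/
def IsSemigroupInverse {S : Type u} [Mul S] (x y : S) : Prop :=
  x * y * x = x ∧ y * x * y = y

/-- An inverse semigroup: every element has exactly one inverse. -/
def IsInverseSemigroup (S : Type u) [Mul S] : Prop :=
  ∀ x : S, ∃! y : S, IsSemigroupInverse x y

/-- A (nonempty) two-sided ideal of a semigroup. -/
def IsTwoSidedIdealSet {S : Type u} [Mul S] (I : Set S) : Prop :=
  I.Nonempty ∧ ∀ x ∈ I, ∀ s : S, s * x ∈ I ∧ x * s ∈ I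

/-- A semigroup with zero is `0`-simple if `{0}` is its unique proper two-sided ideal. -/
def IsZeroSimple (S : Type u) [SemigroupWithZero S] : Prop :=
  ∀ I : Set S, (IsTwoSidedIdealSet I ∧ I ≠ univ) ↔ I = {0}

/-- The natural partial order on idempotents: `e ≼ f` iff `e f = f e = e`. -/
def IdempotentLE {S : Type u} [Mul S] (e f : S) : Prop :=
  e * f = e ∧ f * e = e

/-- A `0`-simple inverse `ω`-semigroup: a `0`-simple inverse semigroup whose set of non-zero
idempotents, with the natural partial order, is order isomorphic to `(ω, ≥)`. -/
structure IsZeroSimpleInverseOmegaSemigroup (S : Type u) [SemigroupWithZero S] : Prop where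
  inverse : IsInverseSemigroup S
  zeroSimple : IsZeroSimple S
  omega : Nonempty
    ((fun e f : {e : S // IsIdempotentElem e ∧ e ≠ 0} => IdempotentLE (e : S) (f : S)) ≃r
      (fun m n : ℕ => m ≥ n))

/-- A subset of a semigroup which is a group under the semigroup operation. -/
def IsSubgroupSet {S : Type u} [Mul S] (H : Set S) : Prop :=
  (∀ x ∈ H, ∀ y ∈ H, x * y ∈ H) ∧
    ∃ e ∈ H, ∀ x ∈ H, e * x = x ∧ x * e = x ∧ ∃ y ∈ H, x * y = e ∧ y * x = e

/-- A maximal subgroup: a subgroup maximal with respect to inclusion. -/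
def IsMaximalSubgroupSet {S : Type u} [Mul S] (H : Set S) : Prop :=
  Maximal IsSubgroupSet H

/-- Green's relation `H`: `a` and `b` generate the same principal left ideal
(`S¹ a = S¹ b`) and the same principal right ideal (`a S¹ = b S¹`). -/
def GreenH {S : Type u} [Mul S] (a b : S) : Prop :=
  insert a (range fun s : S => s * a) = insert b (range fun s : S => s * b) ∧
    insert a (range fun s : S => a * s) = insert b (range fun s : S => b * s)

/-- The `H`-class of `a`. -/
def greenHClass {S : Type u} [Mul S] (a : S) : Set S :=
  {b | GreenH a b}

end AlgebraicNotions

section TopologicalInverse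

/-- A topological inverse semigroup: an inverse semigroup with a topology for which the
multiplication is jointly continuous and the inversion is continuous. -/
structure IsTopologicalInverseSemigroup (S : Type u) [Semigroup S] [TopologicalSpace S] :
    Prop where
  inverse : IsInverseSemigroup S
  continuousMul : ContinuousMul S
  continuousInv : ∃ ι : S → S, (∀ x, IsSemigroupInverse x (ι x)) ∧ Continuous ι

end TopologicalInverse

section StrongSemilattice

/-- The structure homomorphisms `φ_{α,β} : G_α → G_β` (`β ≤ α`) of a strong semilattice of
groups over the semilattice `E`. -/
structure SemilatticeGroupSystem (E : Type v) [SemilatticeInf E] (G : E → Type u)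
    [∀ α, Group (G α)] where
  map : ∀ {α β : E}, β ≤ α → G α →* G β
  map_self : ∀ (α : E) (x : G α), map (le_refl α) x = x
  map_map : ∀ {α β γ : E} (h₁ : β ≤ α) (h₂ : γ ≤ β) (x : G α),
    map h₂ (map h₁ x) = map (h₂.trans h₁) x

variable {E : Type v} [SemilatticeInf E] {G : E → Type u} [∀ α, Group (G α)]

/-- The underlying set of `[E; G_α, φ_{α,β}]`: the disjoint union of the groups `G_α`. -/
def SemilatticeGroupSystem.Total (_Φ : SemilatticeGroupSystem E G) : Type (max u v) :=
  Σ α : E, G α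

namespace SemilatticeGroupSystem

variable (Φ : SemilatticeGroupSystem E G)

theorem total_ext {a b : Φ.Total} (h : a.1 = b.1) (h' : Φ.map h.ge a.2 = b.2) : a = b := by
  obtain ⟨α, x⟩ := a
  obtain ⟨β, y⟩ := b
  dsimp only at h
  subst h
  have : x = y := (Φ.map_self α x).symm.trans h'
  rw [this]

/-- `a * b = (a φ_{α,αβ}) (b φ_{β,αβ})` for `a ∈ G_α`, `b ∈ G_β`. -/
instance : Mul Φ.Total :=
  ⟨fun a b => ⟨a.1 ⊓ b.1, Φ.map inf_le_left a.2 * Φ.map inf_le_right b.2⟩⟩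

instance : Semigroup Φ.Total where
  mul_assoc a b c := by
    refine Φ.total_ext (inf_assoc a.1 b.1 c.1) ?_
    change Φ.map _ (Φ.map _ (Φ.map _ a.2 * Φ.map _ b.2) * Φ.map _ c.2) =
      Φ.map _ a.2 * Φ.map _ (Φ.map _ b.2 * Φ.map _ c.2)
    simp only [map_mul, Φ.map_map, mul_assoc]

/-- If `E` has a greatest element `⊤`, then the unit of `G_⊤` is a unit of `[E; G_α, φ_{α,β}]`. -/
instance [OrderTop E] : Monoid Φ.Total where
  one := ⟨⊤, 1⟩
  one_mul a := by
    refine Φ.total_ext (top_inf_eq a.1) ?_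
    change Φ.map _ (Φ.map _ 1 * Φ.map _ a.2) = a.2
    simp only [Φ.map_map, map_one, one_mul, Φ.map_self]
  mul_one a := by
    refine Φ.total_ext (inf_top_eq a.1) ?_
    change Φ.map _ (Φ.map _ a.2 * Φ.map _ 1) = a.2
    simp only [Φ.map_map, map_one, mul_one, Φ.map_self]

/-- `[E; G_α, φ_{α,β}]` is topologized as the topological sum of the `G_α`. -/
instance [∀ α, TopologicalSpace (G α)] : TopologicalSpace Φ.Total :=
  inferInstanceAs (TopologicalSpace (Σ α : E, G α))

end SemilatticeGroupSystem

end StrongSemilattice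

section BruckReillyExtension

/-- The underlying set `ω × T × ω` of the Bruck--Reilly extension `BR(T, θ)` of a monoid `T`,
where `θ` is a homomorphism from `T` into its group of units. -/
@[ext]
structure BruckReilly (T : Type u) [Monoid T] (θ : T →* Tˣ) where
  left : ℕ
  elt : T
  right : ℕ

namespace BruckReilly

variable {T : Type u} [Monoid T] (θ : T →* Tˣ)

/-- `θ` as an endomorphism of `T`. -/
def endo : T →* T := (Units.coeHom T).comp θ

/-- `(i,s,j)(k,t,l) = (i+k-min{j,k}, (s)θ^{k-min{j,k}} (t)θ^{j-min{j,k}}, j+l-min{j,k})`. -/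
instance : Mul (BruckReilly T θ) :=
  ⟨fun a b =>
    ⟨a.left + b.left - min a.right b.left,
      (endo θ)^[b.left - min a.right b.left] a.elt *
        (endo θ)^[a.right - min a.right b.left] b.elt,
      a.right + b.right - min a.right b.left⟩⟩

instance : Semigroup (BruckReilly T θ) where
  mul_assoc := by
    rintro ⟨i, s, j⟩ ⟨k, t, l⟩ ⟨m, r, n⟩
    apply BruckReilly.ext
    · change i + k - min j k + m - min (j + l - min j k) m =
        i + (k + m - min l m) - min j (k + m - min l m)
      omega
    · change (endo θ)^[m - min (j + l - min j k) m]
          ((endo θ)^[k - min j k] s * (endo θ)^[j - min j k] t) *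
          (endo θ)^[j + l - min j k - min (j + l - min j k) m] r =
        (endo θ)^[k + m - min l m - min j (k + m - min l m)] s *
          (endo θ)^[j - min j (k + m - min l m)]
            ((endo θ)^[m - min l m] t * (endo θ)^[l - min l m] r)
      simp only [iterate_map_mul, ← Function.iterate_add_apply, mul_assoc]
      exact congrArg₂ (· * ·) (congrArg (fun d => (endo θ)^[d] s) (by omega))
        (congrArg₂ (· * ·) (congrArg (fun d => (endo θ)^[d] t) (by omega))
          (congrArg (fun d => (endo θ)^[d] r) (by omega)))
    · change j + l - min j k + n - min (j + l - min j k) m =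
        j + (l + n - min l m) - min j (k + m - min l m)
      omega

end BruckReilly

/-- `BR⁰(T, θ)`: the semigroup `BR(T, θ)` with an adjoined zero. -/
abbrev BruckReillyZero (T : Type u) [Monoid T] (θ : T →* Tˣ) : Type u :=
  WithZero (BruckReilly T θ)

/-- A topology `τ` on `BR⁰(T, θ)` *extends* the topology of `T` if for some `i`, the subspace
`T_{i,i} = {(i, t, i) : t ∈ T}` is homeomorphic to `T` under `(i, t, i) ↦ t`. -/
def ExtendsTopology {T : Type u} [Monoid T] [TopologicalSpace T] (θ : T →* Tˣ)
    (τ : TopologicalSpace (BruckReillyZero T θ)) : Prop :=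
  ∃ i : ℕ, IsEmbedding fun t : T => ((⟨i, t, i⟩ : BruckReilly T θ) : BruckReillyZero T θ)

end BruckReillyExtension

/-! The non-zero idempotents form a chain `idem 0 > idem 1 > ⋯`, so a non-zero `x` has two indices:
`x * x⁻¹ = idem (lidx x)` and `x⁻¹ * x = idem (ridx x)`. Conjugation by `x` carries the tail of the
chain from `ridx x` onto the tail from `lidx x` without gaps (`conj_idem`), hence indices multiply
as in the bicyclic monoid (`lidx_mul`, `ridx_mul`).

By `0`-simplicity some element has left index `0` and positive right index; let `a` be one with
least right index `d`. Euclidean division gives `lidx x ≡ ridx x` mod `d` for all `x ≠ 0`, so each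
non-zero element is uniquely `a⁻ⁱ t aʲ` with `t` in the union `T` of the maximal subgroups at `idem
0, …, idem (d - 1)`. Conjugation by `a` maps `T` into the units, and with `θ` this conjugation `S`
is `BR⁰(T, θ)` (`brEquiv`).

Each non-zero `ℋ`-class is a translate of a maximal subgroup, hence compact. The non-zero elements
with both indices at most `n` form an open set, a finite union of such classes, so each class is
open (`isOpen_hClass`). On compact open classes inversion is continuous, by uniqueness of inverses.
If `S` is locally compact and `0` is not isolated, translations by `a` and `a⁻¹` inside a compact
neighbourhood of `0` yield two sequences tending to `0` with constant non-zero product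
(`isOpen_singleton_zero`). -/

section OmegaFrame

/-- An inverse semigroup with zero together with an enumeration `idem 0 > idem 1 > ⋯` of its
non-zero idempotents and the inversion map. -/
class OmegaFrame (S : Type u) [SemigroupWithZero S] extends Inv S where
  isInverse_inv : ∀ x : S, IsSemigroupInverse x x⁻¹
  eq_inv : ∀ {x y : S}, IsSemigroupInverse x y → y = x⁻¹
  idem : ℕ → S
  idem_mul_idem : ∀ m n, idem m * idem n = idem (max m n)
  idem_ne_zero : ∀ n, idem n ≠ 0
  idem_injective : Function.Injective idem
  exists_idem : ∀ x : S, x * x = x → x ≠ 0 → ∃ n, idem n = x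

theorem IsZeroSimpleInverseOmegaSemigroup.nonempty_omegaFrame {S : Type u} [SemigroupWithZero S]
    (hS : IsZeroSimpleInverseOmegaSemigroup S) : Nonempty (OmegaFrame S) := by
  obtain ⟨φ⟩ := hS.omega
  have hle : ∀ m n, m ≤ n → IdempotentLE (φ.symm n : S) (φ.symm m : S) := fun m n h =>
    φ.symm.map_rel_iff.2 (show n ≥ m from h)
  choose f hf hf' using hS.inverse
  exact ⟨{
    inv := f
    isInverse_inv := hf
    eq_inv := fun {x y} h => hf' x y h
    idem := fun n => φ.symm n
    idem_mul_idem := fun m n => by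
      rcases le_total m n with h | h
      · rw [max_eq_right h]; exact (hle _ _ h).2
      · rw [max_eq_left h]; exact (hle _ _ h).1
    idem_ne_zero := fun n => (φ.symm n).2.2
    idem_injective := fun m n h => φ.symm.injective (Subtype.ext h)
    exists_idem := fun x hx hx0 => ⟨φ ⟨x, hx, hx0⟩, by simp⟩ }⟩

theorem greenHClass_zero {S : Type u} [SemigroupWithZero S] : greenHClass (0 : S) = {0} := by
  ext y
  constructor
  · rintro ⟨h1, -⟩
    have : y ∈ insert (0 : S) (range fun s : S => s * 0) := h1 ▸ mem_insert y _
    simpa using this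
  · rintro rfl
    exact ⟨rfl, rfl⟩

/-! ### Arithmetic of indices: products behave as in the bicyclic monoid. -/

namespace OmegaFrame

variable {S : Type u} [SemigroupWithZero S] [OmegaFrame S]

theorem mul_inv_mul_self (x : S) : x * x⁻¹ * x = x := (isInverse_inv x).1

theorem inv_mul_inv_self (x : S) : x⁻¹ * x * x⁻¹ = x⁻¹ := (isInverse_inv x).2

theorem inv_inv_self (x : S) : x⁻¹⁻¹ = x := (eq_inv ⟨inv_mul_inv_self x, mul_inv_mul_self x⟩).symm

theorem mul_inv_idem (x : S) : x * x⁻¹ * (x * x⁻¹) = x * x⁻¹ := by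
  rw [← mul_assoc, mul_inv_mul_self]

theorem inv_mul_idem (x : S) : x⁻¹ * x * (x⁻¹ * x) = x⁻¹ * x := by
  rw [← mul_assoc, inv_mul_inv_self]

theorem inv_eq_self {x : S} (hx : x * x = x) : x⁻¹ = x :=
  (eq_inv ⟨by rw [hx, hx], by rw [hx, hx]⟩).symm

theorem inv_zero' : (0 : S)⁻¹ = 0 := inv_eq_self (zero_mul 0)

theorem inv_ne_zero' {x : S} (hx : x ≠ 0) : x⁻¹ ≠ 0 := fun h => hx <| by
  rw [← inv_inv_self x, h, inv_zero']

theorem idem_idem (n : ℕ) : (idem n : S) * idem n = idem n := by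
  rw [idem_mul_idem, max_self]

theorem mul_comm_of_idem {x y : S} (hx : x * x = x) (hy : y * y = y) : x * y = y * x := by
  rcases eq_or_ne x 0 with rfl | hx0
  · simp
  rcases eq_or_ne y 0 with rfl | hy0
  · simp
  obtain ⟨m, rfl⟩ := exists_idem x hx hx0
  obtain ⟨n, rfl⟩ := exists_idem y hy hy0
  rw [idem_mul_idem, idem_mul_idem, max_comm]

theorem mul_inv_rev' (x y : S) : (x * y)⁻¹ = y⁻¹ * x⁻¹ := by
  have h := mul_comm_of_idem (inv_mul_idem x) (mul_inv_idem y)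
  refine (eq_inv ⟨?_, ?_⟩).symm
  · calc x * y * (y⁻¹ * x⁻¹) * (x * y) = x * (y * y⁻¹ * (x⁻¹ * x)) * y := by
          simp only [mul_assoc]
      _ = (x * x⁻¹ * x) * (y * y⁻¹ * y) := by rw [← h]; simp only [mul_assoc]
      _ = x * y := by rw [mul_inv_mul_self, mul_inv_mul_self]
  · calc y⁻¹ * x⁻¹ * (x * y) * (y⁻¹ * x⁻¹) = y⁻¹ * (x⁻¹ * x * (y * y⁻¹)) * x⁻¹ := by
          simp only [mul_assoc]
      _ = (y⁻¹ * y * y⁻¹) * (x⁻¹ * x * x⁻¹) := by rw [h]; simp only [mul_assoc]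
      _ = y⁻¹ * x⁻¹ := by rw [inv_mul_inv_self, inv_mul_inv_self]

/-- The implication sits under the quantifier so that `lidx` is total; its value at `0` is
arbitrary. -/
theorem exists_left_index (x : S) : ∃ n, x ≠ 0 → x * x⁻¹ = idem n := by
  rcases eq_or_ne x 0 with rfl | hx
  · exact ⟨0, fun h => (h rfl).elim⟩
  · obtain ⟨n, hn⟩ := exists_idem (x * x⁻¹) (mul_inv_idem x) (fun h => hx <| by
      rw [← mul_inv_mul_self x, h, zero_mul])
    exact ⟨n, fun _ => hn.symm⟩

/-- The index of the idempotent `x * x⁻¹`. -/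
noncomputable def lidx (x : S) : ℕ := (exists_left_index x).choose

/-- The index of the idempotent `x⁻¹ * x`. -/
noncomputable def ridx (x : S) : ℕ := lidx x⁻¹

theorem mul_inv_eq {x : S} (hx : x ≠ 0) : x * x⁻¹ = idem (lidx x) :=
  (exists_left_index x).choose_spec hx

theorem inv_mul_eq {x : S} (hx : x ≠ 0) : x⁻¹ * x = idem (ridx x) := by
  have := mul_inv_eq (inv_ne_zero' hx)
  rwa [inv_inv_self] at this

theorem lidx_eq {x : S} {n : ℕ} (hx : x ≠ 0) (h : x * x⁻¹ = idem n) : lidx x = n :=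
  idem_injective ((mul_inv_eq hx).symm.trans h)

theorem ridx_eq {x : S} {n : ℕ} (hx : x ≠ 0) (h : x⁻¹ * x = idem n) : ridx x = n :=
  idem_injective ((inv_mul_eq hx).symm.trans h)

theorem lidx_inv (x : S) : lidx x⁻¹ = ridx x := rfl

theorem ridx_inv (x : S) : ridx x⁻¹ = lidx x := by rw [ridx, inv_inv_self]

theorem lidx_idem (n : ℕ) : lidx (idem n : S) = n :=
  lidx_eq (idem_ne_zero n) (by rw [inv_eq_self (idem_idem n), idem_idem])

theorem ridx_idem (n : ℕ) : ridx (idem n : S) = n := by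
  rw [ridx, inv_eq_self (idem_idem n), lidx_idem]

theorem idem_lidx_mul {x : S} (hx : x ≠ 0) : idem (lidx x) * x = x := by
  rw [← mul_inv_eq hx, mul_inv_mul_self]

theorem mul_idem_ridx {x : S} (hx : x ≠ 0) : x * idem (ridx x) = x := by
  rw [← inv_mul_eq hx, ← mul_assoc, mul_inv_mul_self]

theorem idem_mul_of_le {x : S} {n : ℕ} (h : n ≤ lidx x) : idem n * x = x := by
  rcases eq_or_ne x 0 with rfl | hx
  · simp
  rw [← idem_lidx_mul hx, ← mul_assoc, idem_mul_idem, max_eq_right h]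

theorem mul_idem_of_le {x : S} {n : ℕ} (h : n ≤ ridx x) : x * idem n = x := by
  rcases eq_or_ne x 0 with rfl | hx
  · simp
  rw [← mul_idem_ridx hx, mul_assoc, idem_mul_idem, max_eq_left h]

theorem idem_mul_eq_iff {x : S} {n : ℕ} (hx : x ≠ 0) : idem n * x = x ↔ n ≤ lidx x := by
  refine ⟨fun h => ?_, idem_mul_of_le⟩
  have : idem n * (x * x⁻¹) = x * x⁻¹ := by rw [← mul_assoc, h]
  rw [mul_inv_eq hx, idem_mul_idem] at this
  exact max_eq_right_iff.1 (idem_injective this)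

theorem mul_idem_eq_iff {x : S} {n : ℕ} (hx : x ≠ 0) : x * idem n = x ↔ n ≤ ridx x := by
  refine ⟨fun h => ?_, mul_idem_of_le⟩
  have : x⁻¹ * x * idem n = x⁻¹ * x := by rw [mul_assoc, h]
  rw [inv_mul_eq hx, idem_mul_idem] at this
  exact max_eq_left_iff.1 (idem_injective this)

theorem mul_ne_zero' {x y : S} (hx : x ≠ 0) (hy : y ≠ 0) : x * y ≠ 0 := fun h => by
  have : x⁻¹ * (x * y) * y⁻¹ = 0 := by rw [h, mul_zero, zero_mul]
  rw [← mul_assoc, mul_assoc, inv_mul_eq hx, mul_inv_eq hy, idem_mul_idem] at this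
  exact idem_ne_zero _ this

instance : Monoid S where
  one := idem 0
  one_mul _ := idem_mul_of_le (Nat.zero_le _)
  mul_one _ := mul_idem_of_le (Nat.zero_le _)

theorem one_eq_idem : (1 : S) = idem 0 := rfl

theorem conj_mul_conj {x : S} (hx : x ≠ 0) {m n : ℕ} (hm : ridx x ≤ m) :
    (x * idem m * x⁻¹) * (x * idem n * x⁻¹) = x * idem (max m n) * x⁻¹ :=
  calc (x * idem m * x⁻¹) * (x * idem n * x⁻¹)
      = x * (idem m * (x⁻¹ * x)) * idem n * x⁻¹ := by simp only [mul_assoc]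
    _ = _ := by
      rw [inv_mul_eq hx, idem_mul_idem, max_eq_left hm, mul_assoc x, idem_mul_idem]

theorem inv_conj_conj {x : S} (hx : x ≠ 0) {m : ℕ} (hm : ridx x ≤ m) :
    x⁻¹ * (x * idem m * x⁻¹) * x = idem m :=
  calc x⁻¹ * (x * idem m * x⁻¹) * x = (x⁻¹ * x) * idem m * (x⁻¹ * x) := by
        simp only [mul_assoc]
    _ = _ := by
      rw [inv_mul_eq hx, idem_mul_idem, max_eq_right hm, idem_mul_idem, max_eq_left hm]

/-- Conjugation by `x` preserves products of idempotents below `x⁻¹ * x`, hence their order; it is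
strict because conjugating back by `x⁻¹` recovers the idempotent. -/
theorem exists_conj_strictMono {x : S} (hx : x ≠ 0) : ∃ g : ℕ → ℕ, StrictMono g ∧
    ∀ k, x * idem (ridx x + k) * x⁻¹ = idem (lidx x + g k) := by
  have key : ∀ k, ∃ n, x * idem (ridx x + k) * x⁻¹ = idem (lidx x + n) := fun k => by
    have h0 : x * idem (ridx x + k) * x⁻¹ ≠ 0 :=
      mul_ne_zero' (mul_ne_zero' hx (idem_ne_zero _)) (inv_ne_zero' hx)
    obtain ⟨n, hn⟩ := exists_idem _ (by
      rw [conj_mul_conj hx (Nat.le_add_right _ _), max_self]) h0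
    have h2 : idem (lidx x) * (x * idem (ridx x + k) * x⁻¹) = x * idem (ridx x + k) * x⁻¹ := by
      rw [← mul_assoc, ← mul_assoc, idem_lidx_mul hx]
    rw [← hn, idem_mul_idem] at h2
    have h3 := max_eq_right_iff.1 (idem_injective h2)
    exact ⟨n - lidx x, by rw [← hn, Nat.add_sub_cancel' h3]⟩
  choose g hg using key
  refine ⟨g, strictMono_nat_of_lt_succ fun k => ?_, hg⟩
  have h1 := conj_mul_conj hx (n := ridx x + (k + 1)) (Nat.le_add_right (ridx x) k)
  rw [max_eq_right (by omega), hg, hg, idem_mul_idem] at h1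
  have h2 := max_eq_right_iff.1 (idem_injective h1)
  refine lt_of_le_of_ne (by omega) fun he => ?_
  have h3 := inv_conj_conj hx (Nat.le_add_right (ridx x) k)
  rw [hg, he, ← hg, inv_conj_conj hx (Nat.le_add_right _ _)] at h3
  have := idem_injective h3
  omega

/-- The strictly increasing maps `g`, `f` attached to `x` and `x⁻¹` satisfy `f (g k) = k`, so `k ≤ g
k ≤ f (g k) = k` forces `g k = k`. -/
theorem conj_idem {x : S} (hx : x ≠ 0) (k : ℕ) :
    x * idem (ridx x + k) * x⁻¹ = idem (lidx x + k) := by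
  obtain ⟨g, hg, hgx⟩ := exists_conj_strictMono hx
  obtain ⟨f, hf, hfx⟩ := exists_conj_strictMono (inv_ne_zero' hx)
  have h := inv_conj_conj hx (Nat.le_add_right (ridx x) k)
  rw [hgx, ← ridx_inv] at h
  have h' := hfx (g k)
  rw [inv_inv_self, h, lidx_inv] at h'
  have h1 := hg.le_apply (x := k)
  have h2 := hf.le_apply (x := g k)
  have h3 := idem_injective h'
  rw [hgx]
  congr 1
  omega

theorem lidx_mul {x y : S} (hx : x ≠ 0) (hy : y ≠ 0) :
    lidx (x * y) = lidx x + (lidx y - ridx x) := by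
  apply lidx_eq (mul_ne_zero' hx hy)
  rw [← conj_idem hx]
  calc x * y * (x * y)⁻¹ = x * (idem (ridx x) * idem (lidx y)) * x⁻¹ := by
        rw [mul_inv_rev', ← mul_assoc x, mul_idem_ridx hx, ← mul_inv_eq hy]
        simp only [mul_assoc]
    _ = _ := by
        rw [idem_mul_idem]
        congr 3
        omega

theorem ridx_mul {x y : S} (hx : x ≠ 0) (hy : y ≠ 0) :
    ridx (x * y) = ridx y + (ridx x - lidx y) := by
  rw [← lidx_inv, mul_inv_rev', lidx_mul (inv_ne_zero' hy) (inv_ne_zero' hx), lidx_inv,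
    lidx_inv, ridx_inv]

/-- Below its own identity, an element of a maximal subgroup fixes every idempotent under
conjugation; idempotents above that identity are absorbed on both sides. -/
theorem idem_mul_comm {x : S} (hx : x ≠ 0) (h : lidx x = ridx x) (n : ℕ) :
    idem n * x = x * idem n := by
  rcases le_total n (lidx x) with hn | hn
  · rw [idem_mul_of_le hn, mul_idem_of_le (h ▸ hn)]
  · have h1 := conj_idem hx (n - ridx x)
    rw [h, Nat.add_sub_cancel' (h ▸ hn)] at h1
    calc idem n * x = x * (idem n * (x⁻¹ * x)) := by
          conv_lhs => rw [← h1]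
          simp only [mul_assoc]
      _ = _ := by rw [inv_mul_eq hx, idem_mul_idem, max_eq_left (h ▸ hn)]

theorem mul_inv_eq_one {x : S} (hx : x ≠ 0) (h : lidx x = 0) : x * x⁻¹ = 1 := by
  rw [mul_inv_eq hx, h]; rfl

theorem one_ne_zero' : (1 : S) ≠ 0 := idem_ne_zero 0

theorem pow_ne_zero' {x : S} (hx : x ≠ 0) (n : ℕ) : x ^ n ≠ 0 := by
  induction n with
  | zero => rw [pow_zero]; exact one_ne_zero'
  | succ n ih => rw [pow_succ]; exact mul_ne_zero' ih hx

theorem inv_pow' (x : S) (n : ℕ) : (x ^ n)⁻¹ = x⁻¹ ^ n := by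
  induction n with
  | zero => rw [pow_zero, pow_zero]; exact inv_eq_self (idem_idem 0)
  | succ n ih => rw [pow_succ, mul_inv_rev', ih, pow_succ']

theorem lidx_pow {x : S} (hx : x ≠ 0) (h : lidx x = 0) (n : ℕ) :
    lidx (x ^ n) = 0 ∧ ridx (x ^ n) = ridx x * n := by
  induction n with
  | zero => rw [pow_zero, one_eq_idem, lidx_idem, ridx_idem]; simp
  | succ n ih =>
    rw [pow_succ, lidx_mul (pow_ne_zero' hx n) hx, ridx_mul (pow_ne_zero' hx n) hx, ih.1, ih.2, h]
    refine ⟨by omega, ?_⟩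
    rw [Nat.mul_succ]; omega

theorem lidx_inv_pow {x : S} (hx : x ≠ 0) (h : lidx x = 0) (n : ℕ) :
    lidx (x⁻¹ ^ n) = ridx x * n := by
  rw [← inv_pow', lidx_inv, (lidx_pow hx h n).2]

theorem ridx_inv_pow {x : S} (hx : x ≠ 0) (h : lidx x = 0) (n : ℕ) :
    ridx (x⁻¹ ^ n) = 0 := by
  rw [← inv_pow', ridx_inv, (lidx_pow hx h n).1]

theorem inv_pow_mul_pow {x : S} (hx : x ≠ 0) (h : lidx x = 0) (n : ℕ) :
    x⁻¹ ^ n * x ^ n = idem (ridx x * n) := by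
  rw [← inv_pow', inv_mul_eq (pow_ne_zero' hx n), (lidx_pow hx h n).2]

theorem pow_mul_inv_pow {x : S} (hx : x ≠ 0) (h : lidx x = 0) (n : ℕ) :
    x ^ n * x⁻¹ ^ n = 1 :=
  pow_mul_pow_eq_one n (mul_inv_eq_one hx h)

/-! ### Consequences of `0`-simplicity: the generator `a`. -/

theorem exists_lidx_eq_zero (h0 : IsZeroSimple S) : ∃ x : S, x ≠ 0 ∧ lidx x = 0 ∧ 1 ≤ ridx x := by
  have hI : IsTwoSidedIdealSet {z : S | ∃ x y, z = x * idem 1 * y} := by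
    refine ⟨⟨_, 1, 1, rfl⟩, ?_⟩
    rintro _ ⟨x, y, rfl⟩ s
    exact ⟨⟨s * x, y, by simp only [mul_assoc]⟩, ⟨x, y * s, by simp only [mul_assoc]⟩⟩
  have hu : {z : S | ∃ x y, z = x * idem 1 * y} = univ := by
    by_contra hne
    have h1 := (h0 _).1 ⟨hI, hne⟩
    have h2 : (idem 1 : S) ∈ {z : S | ∃ x y, z = x * idem 1 * y} := ⟨1, 1, by simp⟩
    rw [h1] at h2
    exact idem_ne_zero 1 h2
  obtain ⟨x, y, hxy⟩ : ∃ x y : S, idem 0 = x * idem 1 * y := hu.ge (mem_univ (idem 0 : S))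
  have hx : x ≠ 0 := by
    rintro rfl
    exact idem_ne_zero (S := S) 0 (by rw [hxy, zero_mul, zero_mul])
  have hy : y ≠ 0 := by
    rintro rfl
    exact idem_ne_zero (S := S) 0 (by rw [hxy, mul_zero])
  -- The left index of `x * idem 1 * y` is at least `lidx x + (1 - ridx x)`; being `0`, it forces
  -- `lidx x = 0` and `ridx x ≥ 1`.
  have hl := congrArg lidx hxy
  rw [lidx_idem, lidx_mul (mul_ne_zero' hx (idem_ne_zero _)) hy, lidx_mul hx (idem_ne_zero _),
    lidx_idem] at hl
  exact ⟨x, hx, by omega, by omega⟩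

/-- An element `a` generating, together with `a⁻¹`, a bicyclic submonoid, such that the number of
`𝒟`-classes is `ridx a`. -/
structure IsGenerator (a : S) : Prop where
  ne_zero : a ≠ 0
  lidx_eq : lidx a = 0
  ridx_pos : 0 < ridx a
  modEq : ∀ x : S, x ≠ 0 → lidx x % ridx a = ridx x % ridx a

theorem exists_isGenerator (h0 : IsZeroSimple S) : ∃ a : S, IsGenerator a := by
  classical
  have hex : ∃ d, 1 ≤ d ∧ ∃ x : S, x ≠ 0 ∧ lidx x = 0 ∧ ridx x = d := by
    obtain ⟨x, hx, h1, h2⟩ := exists_lidx_eq_zero h0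
    exact ⟨_, h2, x, hx, h1, rfl⟩
  obtain ⟨hd, a, ha, hal, har⟩ := Nat.find_spec hex
  have hmin : ∀ x : S, x ≠ 0 → lidx x = 0 → ridx x < ridx a → ridx x = 0 := by
    intro x hx h1 h2
    by_contra h3
    exact Nat.find_min hex (har ▸ h2) ⟨Nat.one_le_iff_ne_zero.2 h3, x, hx, h1, rfl⟩
  -- With `q` the quotient, `x * a⁻¹ ^ q` still has left index `0`, and its right index is the
  -- remainder, which vanishes by minimality.
  have hdvd : ∀ x : S, x ≠ 0 → lidx x = 0 → ridx x % ridx a = 0 := by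
    intro x hx h1
    have hp : a⁻¹ ^ (ridx x / ridx a) ≠ 0 := pow_ne_zero' (inv_ne_zero' ha) _
    have hm := Nat.mod_add_div (ridx x) (ridx a)
    have h3 := hmin (x * a⁻¹ ^ (ridx x / ridx a)) (mul_ne_zero' hx hp)
    rw [lidx_mul hx hp, ridx_mul hx hp, lidx_inv_pow ha hal, ridx_inv_pow ha hal, h1] at h3
    have h4 := Nat.mod_lt (ridx x) (har ▸ hd : 0 < ridx a)
    have := h3 (by omega) (by omega)
    omega
  have hle : ∀ x : S, x ≠ 0 → lidx x ≤ ridx x → lidx x % ridx a = ridx x % ridx a := by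
    intro x hx hx'
    -- The exponent `lidx x` is large enough, as `ridx a ≥ 1`, for `a ^ lidx x * x` to have left
    -- index `0`; its right index is `ridx x - lidx x` modulo `ridx a`.
    have hp : a ^ lidx x ≠ 0 := pow_ne_zero' ha _
    have hpos : 0 < ridx a := har ▸ hd
    have hq : lidx x ≤ ridx a * lidx x := Nat.le_mul_of_pos_left _ hpos
    have hl : lidx (a ^ lidx x * x) = 0 := by
      rw [lidx_mul hp hx, (lidx_pow ha hal _).1, (lidx_pow ha hal _).2]; omega
    have h5 := hdvd _ (mul_ne_zero' hp hx) hl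
    rw [ridx_mul hp hx, (lidx_pow ha hal _).2] at h5
    have h6 : ridx x + (ridx a * lidx x - lidx x) = (ridx x - lidx x) + ridx a * lidx x := by omega
    rw [h6, Nat.add_mul_mod_self_left] at h5
    exact (Nat.modEq_iff_dvd' hx').2 (Nat.dvd_of_mod_eq_zero h5)
  refine ⟨a, ha, hal, har ▸ hd, fun x hx => ?_⟩
  rcases le_total (lidx x) (ridx x) with h | h
  · exact hle x hx h
  · have := hle x⁻¹ (inv_ne_zero' hx) (by rwa [lidx_inv, ridx_inv])
    rw [lidx_inv, ridx_inv] at this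
    exact this.symm

/-! ### Green's `ℋ`-classes and maximal subgroups in terms of indices. -/

theorem greenHClass_eq {x : S} (hx : x ≠ 0) :
    greenHClass x = {y | y ≠ 0 ∧ lidx y = lidx x ∧ ridx y = ridx x} := by
  -- Left multiplication never lowers the right index, and dually below for right multiplication.
  have hl : ∀ {y z : S}, z ≠ 0 → insert y (range fun s => s * y) = insert z (range fun s => s * z) →
      y ≠ 0 ∧ ridx y ≤ ridx z := fun {y z} hz h => by
    rcases (h ▸ mem_insert z _ : z ∈ insert y (range fun s => s * y)) with rfl | ⟨s, rfl⟩
    · exact ⟨hz, le_rfl⟩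
    · have hy : y ≠ 0 := by rintro rfl; exact hz (mul_zero s)
      have hs : s ≠ 0 := by rintro rfl; exact hz (zero_mul y)
      exact ⟨hy, by simp only [ridx_mul hs hy]; omega⟩
  have hr : ∀ {y z : S}, z ≠ 0 → insert y (range fun s => y * s) = insert z (range fun s => z * s) →
      y ≠ 0 ∧ lidx y ≤ lidx z := fun {y z} hz h => by
    rcases (h ▸ mem_insert z _ : z ∈ insert y (range fun s => y * s)) with rfl | ⟨s, rfl⟩
    · exact ⟨hz, le_rfl⟩
    · have hy : y ≠ 0 := by rintro rfl; exact hz (zero_mul s)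
      have hs : s ≠ 0 := by rintro rfl; exact hz (mul_zero y)
      exact ⟨hy, by simp only [lidx_mul hy hs]; omega⟩
  have hl' : ∀ {y z : S}, y ≠ 0 → z ≠ 0 → ridx y = ridx z →
      insert y (range fun s => s * y) ⊆ insert z (range fun s => s * z) := fun {y z} hy hz h => by
    have h1 : y = y * z⁻¹ * z := by rw [mul_assoc, inv_mul_eq hz, ← h, mul_idem_ridx hy]
    rintro w (rfl | ⟨s, rfl⟩)
    · exact Or.inr ⟨_, h1.symm⟩
    · exact Or.inr ⟨s * (y * z⁻¹), by simp only [mul_assoc] at h1 ⊢; rw [← h1]⟩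
  have hr' : ∀ {y z : S}, y ≠ 0 → z ≠ 0 → lidx y = lidx z →
      insert y (range fun s => y * s) ⊆ insert z (range fun s => z * s) := fun {y z} hy hz h => by
    have h1 : y = z * (z⁻¹ * y) := by rw [← mul_assoc, mul_inv_eq hz, ← h, idem_lidx_mul hy]
    rintro w (rfl | ⟨s, rfl⟩)
    · exact Or.inr ⟨_, h1.symm⟩
    · exact Or.inr ⟨z⁻¹ * y * s, by
        simp only [← mul_assoc] at h1 ⊢; rw [← h1]⟩
  ext y
  constructor
  · rintro ⟨h1, h2⟩
    obtain ⟨hy, h3⟩ := hl hx h1.symm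
    exact ⟨hy, (hr hx h2.symm).2.antisymm (hr hy h2).2, h3.antisymm (hl hy h1).2⟩
  · rintro ⟨hy, h1, h2⟩
    exact ⟨(hl' hx hy h2.symm).antisymm (hl' hy hx h2), (hr' hx hy h1.symm).antisymm (hr' hy hx h1)⟩

theorem isMaximalSubgroupSet_idem (n : ℕ) :
    IsMaximalSubgroupSet {x : S | x ≠ 0 ∧ lidx x = n ∧ ridx x = n} := by
  constructor
  · refine ⟨?_, idem n, ⟨idem_ne_zero n, lidx_idem n, ridx_idem n⟩, ?_⟩
    · rintro x ⟨hx, h1, h2⟩ y ⟨hy, h3, h4⟩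
      exact ⟨mul_ne_zero' hx hy, by rw [lidx_mul hx hy]; omega, by rw [ridx_mul hx hy]; omega⟩
    · rintro x ⟨hx, h1, h2⟩
      exact ⟨idem_mul_of_le h1.ge, mul_idem_of_le h2.ge, x⁻¹,
        ⟨inv_ne_zero' hx, by rw [lidx_inv, h2], by rw [ridx_inv, h1]⟩,
        by rw [mul_inv_eq hx, h1], by rw [inv_mul_eq hx, h2]⟩
  · rintro K ⟨-, e, he, hK⟩ hle x hx
    have hn : (idem n : S) ∈ K := hle ⟨idem_ne_zero n, lidx_idem n, ridx_idem n⟩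
    -- An idempotent lying in a group is its identity; group inverses in `K` are then semigroup
    -- inverses, which fixes both indices.
    have hen : idem n = e := by
      obtain ⟨h1, -, y, -, h2, -⟩ := hK _ hn
      rw [← (hK _ hn).2.1, ← h2, ← mul_assoc, idem_idem]
    subst hen
    obtain ⟨h1, h2, y, hy, h3, h4⟩ := hK x hx
    have hxy : y = x⁻¹ := eq_inv ⟨by rw [h3, h1], by rw [h4, (hK y hy).1]⟩
    have hx0 : x ≠ 0 := by
      rintro rfl
      exact idem_ne_zero (S := S) n (by rw [← h3, zero_mul])
    exact ⟨hx0, lidx_eq hx0 (hxy ▸ h3), ridx_eq hx0 (hxy ▸ h4)⟩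

end OmegaFrame

end OmegaFrame

/-! ### The isomorphism of `S` with a Bruck–Reilly extension. -/

section StructureTheorem

namespace OmegaFrame

variable (S : Type u) [SemigroupWithZero S] [OmegaFrame S]

/-- The maximal subgroup of `S` with identity `idem n`. -/
def HGroup (n : ℕ) : Type u := {x : S // x ≠ 0 ∧ lidx x = n ∧ ridx x = n}

variable {S}

namespace HGroup

variable {n : ℕ}

/-- The underlying element of `S`. -/
def val (x : HGroup S n) : S := x.1

theorem val_injective : Function.Injective (val : HGroup S n → S) := Subtype.val_injective

theorem ne_zero (x : HGroup S n) : x.val ≠ 0 := x.2.1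

theorem lidx_val (x : HGroup S n) : lidx x.val = n := x.2.2.1

theorem ridx_val (x : HGroup S n) : ridx x.val = n := x.2.2.2

instance : Mul (HGroup S n) :=
  ⟨fun x y => ⟨x.val * y.val, mul_ne_zero' x.ne_zero y.ne_zero,
    by rw [lidx_mul x.ne_zero y.ne_zero, lidx_val, lidx_val, ridx_val]; omega,
    by rw [ridx_mul x.ne_zero y.ne_zero, lidx_val, ridx_val, ridx_val]; omega⟩⟩

instance : One (HGroup S n) := ⟨⟨idem n, idem_ne_zero n, lidx_idem n, ridx_idem n⟩⟩

instance : Inv (HGroup S n) :=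
  ⟨fun x => ⟨x.val⁻¹, inv_ne_zero' x.ne_zero, x.ridx_val,
    by rw [ridx_inv, lidx_val]⟩⟩

theorem val_mul (x y : HGroup S n) : (x * y).val = x.val * y.val := rfl

theorem val_one : (1 : HGroup S n).val = idem n := rfl

theorem val_inv (x : HGroup S n) : (x⁻¹).val = x.val⁻¹ := rfl

instance : Group (HGroup S n) :=
  Group.ofLeftAxioms (fun x y z => val_injective (mul_assoc x.val y.val z.val))
    (fun x => val_injective (idem_mul_of_le x.lidx_val.ge))
    (fun x => val_injective (by rw [val_mul, val_inv, inv_mul_eq x.ne_zero, ridx_val, val_one]))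

end HGroup

/-- The strong semilattice of the maximal subgroups with identities `idem 0, …, idem (d - 1)`. -/
def system (S : Type u) [SemigroupWithZero S] [OmegaFrame S] (d : ℕ) :
    SemilatticeGroupSystem (Fin d)ᵒᵈ (fun α => HGroup S (OrderDual.ofDual α).val) where
  map {α β} h := MonoidHom.mk' (fun x => ⟨x.val * idem (OrderDual.ofDual β).val,
      mul_ne_zero' x.ne_zero (idem_ne_zero _),
      by
        have : (OrderDual.ofDual α).val ≤ (OrderDual.ofDual β).val := h
        rw [lidx_mul x.ne_zero (idem_ne_zero _), x.lidx_val, x.ridx_val, lidx_idem]; omega,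
      by
        have : (OrderDual.ofDual α).val ≤ (OrderDual.ofDual β).val := h
        rw [ridx_mul x.ne_zero (idem_ne_zero _), x.ridx_val, lidx_idem, ridx_idem]; omega⟩)
    (fun x y => HGroup.val_injective (by
      change x.val * y.val * idem _ = x.val * idem _ * (y.val * idem _)
      rw [← idem_mul_comm y.ne_zero (y.lidx_val.trans y.ridx_val.symm), mul_assoc, mul_assoc,
        ← mul_assoc (idem _), idem_idem,
        idem_mul_comm y.ne_zero (y.lidx_val.trans y.ridx_val.symm)]))
  map_self α x := HGroup.val_injective (mul_idem_of_le x.ridx_val.ge)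
  map_map {α β γ} h₁ h₂ x := HGroup.val_injective (by
    have : (OrderDual.ofDual β).val ≤ (OrderDual.ofDual γ).val := h₂
    change x.val * idem _ * idem _ = x.val * idem _
    rw [mul_assoc, idem_mul_idem, max_eq_right this])

variable {d : ℕ}

/-- The inclusion into `S` of the union of the maximal subgroups with identities
`idem 0, …, idem (d - 1)`. -/
def incl : (system S d).Total →ₙ* S where
  toFun t := t.2.val
  map_mul' s t := by
    obtain ⟨α, x⟩ := s
    obtain ⟨β, y⟩ := t
    change x.val * idem _ * (y.val * idem _) = x.val * y.val
    -- Larger indices are smaller idempotents, so the meet in the order dual is the maximum of the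
    -- indices.
    have hm : (OrderDual.ofDual (α ⊓ β)).val
        = max (OrderDual.ofDual α).val (OrderDual.ofDual β).val :=
      Fin.coe_max (OrderDual.ofDual α) (OrderDual.ofDual β)
    rw [hm, ← idem_mul_comm y.ne_zero (y.lidx_val.trans y.ridx_val.symm), mul_assoc,
      ← mul_assoc (idem _), idem_idem, idem_mul_comm y.ne_zero (y.lidx_val.trans y.ridx_val.symm),
      ← mul_assoc]
    apply mul_idem_of_le
    rw [ridx_mul x.ne_zero y.ne_zero, y.ridx_val, y.lidx_val, x.ridx_val]
    omega

theorem incl_ne_zero (t : (system S d).Total) : incl t ≠ 0 := t.2.ne_zero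

theorem lidx_incl (t : (system S d).Total) : lidx (incl t) = (OrderDual.ofDual t.1).val :=
  t.2.lidx_val

theorem ridx_incl (t : (system S d).Total) : ridx (incl t) = (OrderDual.ofDual t.1).val :=
  t.2.ridx_val

theorem lidx_incl_lt (t : (system S d).Total) : lidx (incl t) < d := by
  rw [lidx_incl]; exact (OrderDual.ofDual t.1).isLt

theorem lidx_eq_ridx_incl (t : (system S d).Total) : lidx (incl t) = ridx (incl t) := by
  rw [lidx_incl, ridx_incl]

theorem exists_incl {x : S} (hx : x ≠ 0) (h : lidx x = ridx x) (hd : lidx x < d) :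
    ∃ t : (system S d).Total, incl t = x :=
  ⟨⟨OrderDual.toDual ⟨lidx x, hd⟩, ⟨x, hx, rfl, h.symm⟩⟩, rfl⟩

theorem incl_injective : Function.Injective (incl : (system S d).Total → S) := by
  rintro ⟨α, x⟩ ⟨β, y⟩ h
  obtain rfl : α = β := by
    exact OrderDual.ofDual.injective (Fin.ext
      ((lidx_incl _).symm.trans ((congrArg lidx h).trans (lidx_incl _))))
  obtain rfl : x = y := HGroup.val_injective h
  rfl

theorem exists_incl_eq_inv (t : (system S d).Total) : ∃ s : (system S d).Total, incl s = (incl t)⁻¹ :=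
  ⟨⟨t.1, t.2⁻¹⟩, rfl⟩

section NeZero

variable [NeZero d]

theorem incl_one : incl (1 : (system S d).Total) = 1 := by
  change idem _ = idem 0
  congr 1

/-- The inclusion of the group of units of `S`. -/
noncomputable def unitIncl : HGroup S 0 →* (system S d).Total where
  toFun x := ⟨⊤, ⟨x.val, x.ne_zero, x.lidx_val, x.ridx_val⟩⟩
  map_one' := rfl
  map_mul' x y := incl_injective (by
    refine Eq.trans ?_ (map_mul incl _ _).symm
    rfl)

end NeZero

namespace IsGenerator

/-- Both indices of `t` are below `ridx a`, so `a * t` has the same indices `0` and `ridx a` as `a`,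
and multiplying by `a⁻¹` lands in the group of units. -/
theorem conj_mem {a : S} (t : (system S (ridx a)).Total) (ha : IsGenerator a) :
    a * incl t * a⁻¹ ≠ 0 ∧ lidx (a * incl t * a⁻¹) = 0 ∧ ridx (a * incl t * a⁻¹) = 0 := by
  have h1 := mul_ne_zero' ha.ne_zero (incl_ne_zero t)
  have h2 := lidx_incl_lt t
  have h3 := lidx_eq_ridx_incl t
  have h4 := ha.lidx_eq
  refine ⟨mul_ne_zero' h1 (inv_ne_zero' ha.ne_zero), ?_, ?_⟩
  · rw [lidx_mul h1 (inv_ne_zero' ha.ne_zero), lidx_mul ha.ne_zero (incl_ne_zero t),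
      ridx_mul ha.ne_zero (incl_ne_zero t), lidx_inv]
    omega
  · rw [ridx_mul h1 (inv_ne_zero' ha.ne_zero), ridx_mul ha.ne_zero (incl_ne_zero t), ridx_inv, lidx_inv]
    omega

theorem incl_comm_inv_mul {a : S} (t : (system S (ridx a)).Total) :
    incl t * idem (ridx a) = idem (ridx a) * incl t :=
  (idem_mul_comm (incl_ne_zero t) (lidx_eq_ridx_incl t) _).symm

variable {a : S} (ha : IsGenerator a)

include ha

theorem inv_ne_zero : a⁻¹ ≠ 0 := inv_ne_zero' ha.ne_zero

theorem mul_inv_eq_one : a * a⁻¹ = 1 := OmegaFrame.mul_inv_eq_one ha.ne_zero ha.lidx_eq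

theorem inv_mul_eq : a⁻¹ * a = idem (ridx a) := OmegaFrame.inv_mul_eq ha.ne_zero

theorem pow_ne_zero (n : ℕ) : a ^ n ≠ 0 := pow_ne_zero' ha.ne_zero n

theorem inv_pow_ne_zero (n : ℕ) : a⁻¹ ^ n ≠ 0 := pow_ne_zero' ha.inv_ne_zero n

theorem neZero : NeZero (ridx a) := ⟨ha.ridx_pos.ne'⟩

theorem word_ne_zero {x : S} (hx : x ≠ 0) (i j : ℕ) : a⁻¹ ^ i * x * a ^ j ≠ 0 :=
  mul_ne_zero' (mul_ne_zero' (ha.inv_pow_ne_zero i) hx) (ha.pow_ne_zero j)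

theorem lidx_word {x : S} (hx : x ≠ 0) (i j : ℕ) :
    lidx (a⁻¹ ^ i * x * a ^ j) = ridx a * i + lidx x := by
  rw [lidx_mul (mul_ne_zero' (ha.inv_pow_ne_zero i) hx) (ha.pow_ne_zero j),
    lidx_mul (ha.inv_pow_ne_zero i) hx, lidx_inv_pow ha.ne_zero ha.lidx_eq,
    ridx_inv_pow ha.ne_zero ha.lidx_eq, (lidx_pow ha.ne_zero ha.lidx_eq j).1]
  omega

theorem ridx_word {x : S} (hx : x ≠ 0) (i j : ℕ) :
    ridx (a⁻¹ ^ i * x * a ^ j) = ridx a * j + ridx x := by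
  rw [ridx_mul (mul_ne_zero' (ha.inv_pow_ne_zero i) hx) (ha.pow_ne_zero j),
    ridx_mul (ha.inv_pow_ne_zero i) hx,
    ridx_inv_pow ha.ne_zero ha.lidx_eq, (lidx_pow ha.ne_zero ha.lidx_eq j).1,
    (lidx_pow ha.ne_zero ha.lidx_eq j).2]
  omega

theorem pow_mul_word_mul_inv_pow (x : S) (i j : ℕ) :
    a ^ i * (a⁻¹ ^ i * x * a ^ j) * a⁻¹ ^ j = x := by
  calc a ^ i * (a⁻¹ ^ i * x * a ^ j) * a⁻¹ ^ j
      = (a ^ i * a⁻¹ ^ i) * x * (a ^ j * a⁻¹ ^ j) := by simp only [mul_assoc]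
    _ = x := by
      rw [pow_mul_inv_pow ha.ne_zero ha.lidx_eq, pow_mul_inv_pow ha.ne_zero ha.lidx_eq, one_mul,
        mul_one]

theorem word_pow_mul {x : S} {i j : ℕ} (hi : ridx a * i ≤ lidx x) (hj : ridx a * j ≤ ridx x) :
    a⁻¹ ^ i * (a ^ i * x * a⁻¹ ^ j) * a ^ j = x := by
  calc a⁻¹ ^ i * (a ^ i * x * a⁻¹ ^ j) * a ^ j
      = (a⁻¹ ^ i * a ^ i) * x * (a⁻¹ ^ j * a ^ j) := by simp only [mul_assoc]
    _ = x := by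
      rw [inv_pow_mul_pow ha.ne_zero ha.lidx_eq, inv_pow_mul_pow ha.ne_zero ha.lidx_eq,
        idem_mul_of_le hi, mul_idem_of_le hj]

/-- The exponents are the quotients of the indices by `ridx a`; the remainders agree by `modEq`, so
stripping these powers leaves an element of a maximal subgroup. -/
theorem exists_word {x : S} (hx : x ≠ 0) : ∃ (i j : ℕ) (y : S), y ≠ 0 ∧ lidx y = ridx y ∧
    lidx y < ridx a ∧ a⁻¹ ^ i * y * a ^ j = x := by
  have hi := ha.inv_pow_ne_zero (ridx x / ridx a)
  have hj := ha.pow_ne_zero (lidx x / ridx a)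
  have h1 := Nat.mod_add_div (lidx x) (ridx a)
  have h2 := Nat.mod_add_div (ridx x) (ridx a)
  have h3 := Nat.mod_lt (lidx x) ha.ridx_pos
  have h4 := Nat.mod_lt (ridx x) ha.ridx_pos
  have h5 := ha.modEq x hx
  have hl : lidx (a ^ (lidx x / ridx a) * x * a⁻¹ ^ (ridx x / ridx a)) = lidx x % ridx a := by
    rw [lidx_mul (mul_ne_zero' hj hx) hi, lidx_mul hj hx, ridx_mul hj hx,
      lidx_inv_pow ha.ne_zero ha.lidx_eq,
      (lidx_pow ha.ne_zero ha.lidx_eq _).1, (lidx_pow ha.ne_zero ha.lidx_eq _).2]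
    omega
  have hr : ridx (a ^ (lidx x / ridx a) * x * a⁻¹ ^ (ridx x / ridx a)) = ridx x % ridx a := by
    rw [ridx_mul (mul_ne_zero' hj hx) hi, ridx_mul hj hx, lidx_inv_pow ha.ne_zero ha.lidx_eq,
      ridx_inv_pow ha.ne_zero ha.lidx_eq, (lidx_pow ha.ne_zero ha.lidx_eq _).2]
    omega
  exact ⟨lidx x / ridx a, ridx x / ridx a, _, mul_ne_zero' (mul_ne_zero' hj hx) hi,
    by rw [hl, hr, h5], by rwa [hl], ha.word_pow_mul (by omega) (by omega)⟩

end IsGenerator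

/-- The homomorphism `t ↦ a * t * a⁻¹` into the group of units. -/
noncomputable def conjHom (a : S) (ha : IsGenerator a) [NeZero (ridx a)] :
    (system S (ridx a)).Total →* HGroup S 0 where
  toFun t := ⟨a * incl t * a⁻¹, IsGenerator.conj_mem t ha⟩
  map_one' := HGroup.val_injective (by
    change a * incl 1 * a⁻¹ = 1
    rw [incl_one, mul_one, ha.mul_inv_eq_one])
  map_mul' s t := HGroup.val_injective (by
    change a * incl (s * t) * a⁻¹ = a * incl s * a⁻¹ * (a * incl t * a⁻¹)
    -- The inserted idempotent `a⁻¹ * a = idem (ridx a)` commutes with `incl s`, so it can be moved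
    -- between the two factors.
    calc a * incl (s * t) * a⁻¹ = (a * a⁻¹ * a) * (incl s * incl t) * a⁻¹ := by
          rw [map_mul, mul_inv_mul_self]
      _ = a * (idem (ridx a) * incl s) * incl t * a⁻¹ := by
          rw [← ha.inv_mul_eq]; simp only [mul_assoc]
      _ = _ := by
          rw [← IsGenerator.incl_comm_inv_mul, ← ha.inv_mul_eq]; simp only [mul_assoc])

/-- The homomorphism `t ↦ a * t * a⁻¹` into the units of `[E; G_α, φ_{α,β}]`. -/
noncomputable def theta (a : S) (ha : IsGenerator a) [NeZero (ridx a)] :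
    (system S (ridx a)).Total →* (system S (ridx a)).Totalˣ :=
  ((Units.map unitIncl).comp toUnits.toMonoidHom).comp (conjHom a ha)

section Isomorphism

variable {a : S} (ha : IsGenerator a) [NeZero (ridx a)]

theorem incl_endo (t : (system S (ridx a)).Total) :
    incl (BruckReilly.endo (theta a ha) t) = a * incl t * a⁻¹ := rfl

/-- Moving `a` past an element of `T` applies `θ`; iterated, this rule and its mirror image for
`a⁻¹` produce the Bruck–Reilly product. -/
theorem mul_incl (t : (system S (ridx a)).Total) :
    a * incl t = incl (BruckReilly.endo (theta a ha) t) * a := by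
  rw [incl_endo, mul_assoc _ a⁻¹, ha.inv_mul_eq, mul_assoc, IsGenerator.incl_comm_inv_mul,
    ← mul_assoc, mul_idem_ridx ha.ne_zero]

theorem incl_mul_inv (t : (system S (ridx a)).Total) :
    incl t * a⁻¹ = a⁻¹ * incl (BruckReilly.endo (theta a ha) t) := by
  rw [incl_endo, ← mul_assoc, ← mul_assoc, ha.inv_mul_eq, ← IsGenerator.incl_comm_inv_mul,
    mul_assoc, idem_mul_of_le (x := a⁻¹) (by rw [lidx_inv])]

theorem pow_mul_incl (n : ℕ) (t : (system S (ridx a)).Total) :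
    a ^ n * incl t = incl ((BruckReilly.endo (theta a ha))^[n] t) * a ^ n := by
  induction n generalizing t with
  | zero => simp
  | succ n ih =>
    rw [pow_succ, mul_assoc, mul_incl ha, ← mul_assoc, ih, Function.iterate_succ_apply, mul_assoc]

theorem incl_mul_inv_pow (n : ℕ) (t : (system S (ridx a)).Total) :
    incl t * a⁻¹ ^ n = a⁻¹ ^ n * incl ((BruckReilly.endo (theta a ha))^[n] t) := by
  induction n generalizing t with
  | zero => simp
  | succ n ih =>
    rw [pow_succ', ← mul_assoc, incl_mul_inv ha, mul_assoc, ih, Function.iterate_succ_apply,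
      mul_assoc]

/-- The embedding `(i, t, j) ↦ a⁻ⁱ t aʲ` of the Bruck--Reilly extension. -/
noncomputable def brHom : BruckReilly (system S (ridx a)).Total (theta a ha) →ₙ* S where
  toFun x := a⁻¹ ^ x.left * incl x.elt * a ^ x.right
  map_mul' := by
    rintro ⟨i, s, j⟩ ⟨k, t, l⟩
    change a⁻¹ ^ (i + k - min j k) * incl ((BruckReilly.endo (theta a ha))^[k - min j k] s *
      (BruckReilly.endo (theta a ha))^[j - min j k] t) * a ^ (j + l - min j k) =
      (a⁻¹ ^ i * incl s * a ^ j) * (a⁻¹ ^ k * incl t * a ^ l)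
    rw [map_mul]
    -- In the middle factor `aʲ a⁻ᵏ` the common power cancels because `a * a⁻¹ = 1`; the surplus
    -- power is moved outwards past `s` or `t`.
    rcases le_total j k with h | h
    · obtain ⟨n, rfl⟩ := Nat.exists_eq_add_of_le h
      rw [min_eq_left h, show i + (j + n) - j = i + n by omega, show j + n - j = n by omega,
        show j - j = 0 by omega, show j + l - j = l by omega, pow_add, pow_add]
      calc _ = a⁻¹ ^ i * (a⁻¹ ^ n * incl ((BruckReilly.endo (theta a ha))^[n] s)) * incl t * a ^ l
            := by simp only [mul_assoc, Function.iterate_zero_apply]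
        _ = a⁻¹ ^ i * incl s * (a ^ j * a⁻¹ ^ j) * a⁻¹ ^ n * incl t * a ^ l := by
          rw [← incl_mul_inv_pow ha, pow_mul_inv_pow ha.ne_zero ha.lidx_eq, mul_one]
          simp only [mul_assoc]
        _ = _ := by simp only [mul_assoc]
    · obtain ⟨n, rfl⟩ := Nat.exists_eq_add_of_le h
      rw [min_eq_right h, show i + k - k = i by omega, show k + n - k = n by omega,
        show k - k = 0 by omega, show k + n + l - k = n + l by omega, add_comm k n, pow_add,
        pow_add]
      calc _ = a⁻¹ ^ i * incl s * (incl ((BruckReilly.endo (theta a ha))^[n] t) * a ^ n) * a ^ l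
            := by simp only [mul_assoc, Function.iterate_zero_apply]
        _ = a⁻¹ ^ i * incl s * a ^ n * (a ^ k * a⁻¹ ^ k) * incl t * a ^ l := by
          rw [← pow_mul_incl ha, pow_mul_inv_pow ha.ne_zero ha.lidx_eq, mul_one]
          simp only [mul_assoc]
        _ = _ := by simp only [mul_assoc]

theorem brHom_mk (i : ℕ) (t : (system S (ridx a)).Total) (j : ℕ) :
    brHom ha ⟨i, t, j⟩ = a⁻¹ ^ i * incl t * a ^ j := rfl

theorem brHom_ne_zero (x) : brHom ha x ≠ 0 := ha.word_ne_zero (incl_ne_zero _) _ _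

/-- The indices of `a⁻ⁱ t aʲ` are `ridx a * i + r` and `ridx a * j + r` with `r < ridx a`, so
division recovers `i` and `j`; then the powers cancel. -/
theorem brHom_injective : Function.Injective (brHom ha) := by
  have key : ∀ {i i' r r' : ℕ}, r < ridx a → r' < ridx a →
      ridx a * i + r = ridx a * i' + r' → i = i' := fun {i i' r r'} h h' he => by
    have := congrArg (· / ridx a) he
    simpa [Nat.mul_add_div ha.ridx_pos, Nat.div_eq_of_lt h, Nat.div_eq_of_lt h'] using this
  rintro ⟨i, s, j⟩ ⟨k, t, l⟩ h
  rw [brHom_mk, brHom_mk] at h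
  have hl := congrArg lidx h
  have hr := congrArg ridx h
  rw [ha.lidx_word (incl_ne_zero _), ha.lidx_word (incl_ne_zero _)] at hl
  rw [ha.ridx_word (incl_ne_zero _), ha.ridx_word (incl_ne_zero _), ← lidx_eq_ridx_incl,
    ← lidx_eq_ridx_incl] at hr
  obtain rfl := key (lidx_incl_lt s) (lidx_incl_lt t) hl
  obtain rfl := key (lidx_incl_lt s) (lidx_incl_lt t) hr
  obtain rfl : s = t := incl_injective (by
    rw [← ha.pow_mul_word_mul_inv_pow (incl s) i j, h, ha.pow_mul_word_mul_inv_pow])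
  rfl

theorem exists_brHom {x : S} (hx : x ≠ 0) : ∃ y, brHom ha y = x := by
  obtain ⟨i, j, y, hy, h1, h2, rfl⟩ := ha.exists_word hx
  obtain ⟨t, rfl⟩ := exists_incl hy h1 h2
  exact ⟨⟨i, t, j⟩, rfl⟩

/-- The map `BR⁰(T, θ) → S` extending `brHom` by zero. -/
noncomputable def brZeroFun (x : BruckReillyZero (system S (ridx a)).Total (theta a ha)) : S :=
  WithZero.recZeroCoe (motive := fun _ => S) 0 (brHom ha) x

theorem brZeroFun_zero : brZeroFun ha 0 = 0 := rfl

theorem brZeroFun_coe (x : BruckReilly (system S (ridx a)).Total (theta a ha)) :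
    brZeroFun ha x = brHom ha x := rfl

/-- The structure theorem: `S` is isomorphic to `BR⁰(T, θ)`. -/
noncomputable def brEquiv : BruckReillyZero (system S (ridx a)).Total (theta a ha) ≃* S :=
  MulEquiv.ofBijective
    (⟨brZeroFun ha, fun x y => by
      induction x using WithZero.recZeroCoe with
      | zero => rw [zero_mul, brZeroFun_zero, zero_mul]
      | coe x =>
        induction y using WithZero.recZeroCoe with
        | zero => rw [mul_zero, brZeroFun_zero, mul_zero]
        | coe y => rw [← WithZero.coe_mul, brZeroFun_coe, brZeroFun_coe, brZeroFun_coe, map_mul]⟩ :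
      BruckReillyZero (system S (ridx a)).Total (theta a ha) →ₙ* S)
    ⟨by
      intro x y h
      change brZeroFun ha x = brZeroFun ha y at h
      induction x using WithZero.recZeroCoe with
      | zero =>
        induction y using WithZero.recZeroCoe with
        | zero => rfl
        | coe y => exact (brHom_ne_zero ha y h.symm).elim
      | coe x =>
        induction y using WithZero.recZeroCoe with
        | zero => exact (brHom_ne_zero ha x h).elim
        | coe y => rw [brHom_injective ha h],
    fun x => by
      rcases eq_or_ne x 0 with rfl | hx
      · exact ⟨0, rfl⟩
      · obtain ⟨y, rfl⟩ := exists_brHom ha hx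
        exact ⟨y, rfl⟩⟩

end Isomorphism

end OmegaFrame

end StructureTheorem

/-! ### Topology of the `ℋ`-classes, continuity of inversion, isolation of zero. -/

section TopologicalOmega

open Filter

namespace OmegaFrame

variable {S : Type u} [SemigroupWithZero S] [OmegaFrame S]

variable (S) in
/-- The `ℋ`-class of the non-zero elements with left index `k` and right index `l`. -/
def hClass (k l : ℕ) : Set S := {x | x ≠ 0 ∧ lidx x = k ∧ ridx x = l}

variable (S) in
/-- The set of non-zero elements with both indices at most `n`. -/
def box (n : ℕ) : Set S := {x | x ≠ 0 ∧ lidx x ≤ n ∧ ridx x ≤ n}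

theorem mem_hClass_self {x : S} (hx : x ≠ 0) : x ∈ hClass S (lidx x) (ridx x) := ⟨hx, rfl, rfl⟩

theorem box_eq_iUnion (n : ℕ) :
    box S n = ⋃ p : Fin (n + 1) × Fin (n + 1), hClass S p.1 p.2 := by
  ext x
  simp only [mem_iUnion]
  constructor
  · rintro ⟨hx, h1, h2⟩
    exact ⟨(⟨lidx x, by omega⟩, ⟨ridx x, by omega⟩), mem_hClass_self hx⟩
  · rintro ⟨⟨i, j⟩, hx, h1, h2⟩
    dsimp only at h1 h2
    exact ⟨hx, by omega, by omega⟩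

/-- This form makes boxes open in a Hausdorff space; `0` is excluded because it is fixed by both
translations. -/
theorem box_eq_compl (n : ℕ) :
    box S n = {x | idem (n + 1) * x ≠ x} ∩ {x | x * idem (n + 1) ≠ x} := by
  ext x
  rcases eq_or_ne x 0 with rfl | hx
  · simp [box]
  · simp only [box, mem_inter_iff, mem_ofPred_eq, ne_eq, idem_mul_eq_iff hx, mul_idem_eq_iff hx]
    simp only [hx, not_false_eq_true, true_and]
    omega

/-- Green's lemma: translation by `b⁻¹` undoes translation by `b`. It transfers compactness from the
maximal subgroups. -/
theorem hClass_eq_image {b : S} (hb : b ≠ 0) :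
    hClass S (lidx b) (ridx b) = (b * ·) '' hClass S (ridx b) (ridx b) := by
  ext x
  constructor
  · rintro ⟨hx, h1, h2⟩
    refine ⟨b⁻¹ * x, ⟨mul_ne_zero' (inv_ne_zero' hb) hx, ?_, ?_⟩, ?_⟩
    · rw [lidx_mul (inv_ne_zero' hb) hx, lidx_inv, ridx_inv]; omega
    · rw [ridx_mul (inv_ne_zero' hb) hx, ridx_inv]; omega
    · change b * (b⁻¹ * x) = x
      rw [← mul_assoc, mul_inv_eq hb, idem_mul_of_le h1.ge]
  · rintro ⟨y, ⟨hy, h1, h2⟩, rfl⟩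
    exact ⟨mul_ne_zero' hb hy, by simp only [lidx_mul hb hy]; omega,
      by simp only [ridx_mul hb hy]; omega⟩

variable [TopologicalSpace S] [ContinuousMul S]

theorem isCompact_hClass (hc : ∀ H : Set S, IsMaximalSubgroupSet H → IsCompact H) (k l : ℕ) :
    IsCompact (hClass S k l) := by
  rcases (hClass S k l).eq_empty_or_nonempty with h | ⟨b, hb, rfl, rfl⟩
  · rw [h]; exact isCompact_empty
  · rw [hClass_eq_image hb]
    exact (hc _ (isMaximalSubgroupSet_idem _)).image (continuous_const_mul b)

theorem isCompact_box (hc : ∀ H : Set S, IsMaximalSubgroupSet H → IsCompact H) (n : ℕ) :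
    IsCompact (box S n) := by
  rw [box_eq_iUnion]
  exact isCompact_iUnion fun _ => isCompact_hClass hc _ _

variable [T2Space S]

theorem isOpen_box (n : ℕ) : IsOpen (box S n) := by
  rw [box_eq_compl]
  exact (isOpen_ne_fun (continuous_const_mul _) continuous_id).inter
    (isOpen_ne_fun (continuous_mul_const _) continuous_id)

theorem isOpen_hClass (hc : ∀ H : Set S, IsMaximalSubgroupSet H → IsCompact H) (k l : ℕ) :
    IsOpen (hClass S k l) := by
  have h : hClass S k l = box S (max k l) \
      ⋃ p : {p : Fin (max k l + 1) × Fin (max k l + 1) // ¬ (p.1.val = k ∧ p.2.val = l)},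
        hClass S p.1.1 p.1.2 := by
    ext x
    simp only [Set.mem_sdiff, mem_iUnion, not_exists]
    constructor
    · rintro ⟨hx, h1, h2⟩
      refine ⟨⟨hx, by omega, by omega⟩, ?_⟩
      rintro ⟨p, hp⟩ ⟨-, h3, h4⟩
      dsimp only at h3 h4
      exact hp ⟨by omega, by omega⟩
    · rintro ⟨⟨hx, h1, h2⟩, h3⟩
      by_contra hne
      exact h3 ⟨(⟨lidx x, by omega⟩, ⟨ridx x, by omega⟩), fun h4 => hne ⟨hx, h4⟩⟩
        (mem_hClass_self hx)
  rw [h]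
  exact (isOpen_box _).sdiff
    (isClosed_iUnion_of_finite fun _ => (isCompact_hClass hc _ _).isClosed)

/-- Along an ultrafilter tending to `x`, the inverses stay in a compact class and converge to some
`z`; passing to the limit in the defining identities shows that `z` is an inverse of `x`, so `z =
x⁻¹`. -/
theorem continuousAt_inv_of_ne_zero (hc : ∀ H : Set S, IsMaximalSubgroupSet H → IsCompact H)
    {x : S} (hx : x ≠ 0) : ContinuousAt (fun y : S => y⁻¹) x := by
  rw [ContinuousAt, tendsto_iff_ultrafilter]
  intro F hF
  have hmem : ∀ᶠ y in (F : Filter S), y⁻¹ ∈ hClass S (ridx x) (lidx x) := by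
    filter_upwards [hF ((isOpen_hClass hc _ _).mem_nhds (mem_hClass_self hx))] with y hy
    exact ⟨inv_ne_zero' hy.1, hy.2.2, by rw [ridx_inv]; exact hy.2.1⟩
  obtain ⟨z, -, hz⟩ := (isCompact_hClass hc (ridx x) (lidx x)).ultrafilter_le_nhds
    (F.map fun y : S => y⁻¹) (le_principal_iff.2 hmem)
  have hz' : Tendsto (fun y : S => y⁻¹) F (𝓝 z) := hz
  have hx' : Tendsto (fun y : S => y) F (𝓝 x) := hF
  have h1 : x * z * x = x := tendsto_nhds_unique ((hx'.mul hz').mul hx') (by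
    simpa only [mul_inv_mul_self] using hx')
  have h2 : z * x * z = z := tendsto_nhds_unique ((hz'.mul hx').mul hz') (by
    simpa only [inv_mul_inv_self] using hz')
  rwa [← eq_inv ⟨h1, h2⟩]

theorem exists_subset_box {K : Set S} (hK : IsCompact K) (h0 : (0 : S) ∉ K) :
    ∃ n, K ⊆ box S n := by
  refine hK.elim_directed_cover (box S) isOpen_box (fun x hx => ?_) ?_
  · exact mem_iUnion.2 ⟨max (lidx x) (ridx x), fun h => h0 (h ▸ hx), le_max_left _ _,
      le_max_right _ _⟩
  · exact directed_of_isDirected_le fun m n hmn x hx =>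
      ⟨hx.1, hx.2.1.trans hmn, hx.2.2.trans hmn⟩

/-- In the locally compact case the zero is isolated. -/
theorem isOpen_singleton_zero [LocallyCompactSpace S] (h0 : IsZeroSimple S)
    (hc : ∀ H : Set S, IsMaximalSubgroupSet H → IsCompact H) : IsOpen ({0} : Set S) := by
  by_contra hno
  obtain ⟨a, ha⟩ := exists_isGenerator h0
  obtain ⟨K, hK, hK0⟩ := exists_compact_mem_nhds (0 : S)
  have hev : ∀ᶠ x in 𝓝 (0 : S), a * x ∈ K ∧ a⁻¹ * x ∈ K ∧ x * a ∈ K ∧ x * a⁻¹ ∈ K := by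
    have hl : ∀ b : S, ∀ᶠ x in 𝓝 (0 : S), b * x ∈ K := fun b =>
      (continuous_const_mul b).continuousAt.eventually_mem (by rwa [mul_zero])
    have hr : ∀ b : S, ∀ᶠ x in 𝓝 (0 : S), x * b ∈ K := fun b =>
      (continuous_mul_const b).continuousAt.eventually_mem (by rwa [zero_mul])
    exact (hl a).and ((hl a⁻¹).and ((hr a).and (hr a⁻¹)))
  -- `K` minus the interior of `U` is compact and misses `0`, hence lies in a box: elements of `K`
  -- with a large index are close to `0`.
  have key : ∀ U ∈ 𝓝 (0 : S), ∃ N, ∀ x ∈ K, x ≠ 0 → N < lidx x ∨ N < ridx x → x ∈ U := by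
    intro U hU
    obtain ⟨N, hN⟩ := exists_subset_box (hK.diff (isOpen_interior (s := U)))
      (fun h => h.2 (mem_interior_iff_mem_nhds.2 hU))
    refine ⟨N, fun x hx hx0 hlr => interior_subset ?_⟩
    by_contra hxU
    have := (hN ⟨hx, hxU⟩).2
    omega
  -- Outside the box of size `N`, all four translations by `a` and `a⁻¹` keep elements of `K` in
  -- `K`.
  obtain ⟨N, hN⟩ := key _ hev
  obtain ⟨x, hxK, hx0, hxN⟩ : ∃ x ∈ K, x ≠ 0 ∧ (N < lidx x ∨ N < ridx x) := by
    by_contra! hcon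
    apply hno
    rw [isOpen_singleton_iff_nhds_eq_pure]
    refine le_antisymm ?_ (pure_le_nhds 0)
    rw [le_pure_iff]
    filter_upwards [hK0, (isCompact_box hc N).isClosed.isOpen_compl.mem_nhds
      (show (0 : S) ∈ (box S N)ᶜ from fun h => h.1 rfl)] with x hx hxb
    by_contra hx0
    exact hxb ⟨hx0, hcon x hx hx0⟩
  obtain ⟨i₀, j₀, y, hy, hy1, hy2, rfl⟩ := ha.exists_word hx0
  have hpos := ha.ridx_pos
  set w : ℕ → ℕ → S := fun i j => a⁻¹ ^ i * y * a ^ j with hw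
  have hw0 : ∀ i j, w i j ≠ 0 := fun i j => ha.word_ne_zero hy i j
  have hlw : ∀ i j, lidx (w i j) = ridx a * i + lidx y := fun i j => ha.lidx_word hy i j
  have hrw : ∀ i j, ridx (w i j) = ridx a * j + ridx y := fun i j => ha.ridx_word hy i j
  have hle : ∀ i, i ≤ ridx a * i := fun i => Nat.le_mul_of_pos_left _ hpos
  have hl1 : ∀ i j, a⁻¹ * w i j = w (i + 1) j := fun i j => by
    simp only [hw, pow_succ', mul_assoc]
  have hr1 : ∀ i j, w i j * a = w i (j + 1) := fun i j => by
    simp only [hw, pow_succ, mul_assoc]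
  have hl2 : ∀ i j, a * w (i + 1) j = w i j := fun i j => by
    rw [← hl1, ← mul_assoc, ha.mul_inv_eq_one, one_mul]
  have hr2 : ∀ i j, w i (j + 1) * a⁻¹ = w i j := fun i j => by
    rw [← hr1, mul_assoc, ha.mul_inv_eq_one, mul_one]
  have hright : ∀ i j n, w i j ∈ K → N < lidx (w i j) ∨ N < ridx (w i j) →
      w i (j + n) ∈ K := by
    intro i j n h1 h2
    induction n with
    | zero => exact h1
    | succ n ih =>
      rw [← add_assoc, ← hr1]
      refine (hN _ ih (hw0 _ _) ?_).2.2.1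
      rw [hlw, hrw] at h2 ⊢
      have := Nat.mul_add (ridx a) j n
      omega
  -- When exponents decrease, the index bound is needed at the end point, so that the whole path
  -- avoids the box.
  have hdown : ∀ i j n, w (i + n) j ∈ K → N < lidx (w i j) ∨ N < ridx (w i j) →
      w i j ∈ K := by
    intro i j n h1 h2
    induction n with
    | zero => exact h1
    | succ n ih =>
      refine ih ?_
      rw [← hl2]
      refine (hN _ h1 (hw0 _ _) ?_).1
      rw [hlw, hrw] at h2 ⊢
      have := Nat.mul_add (ridx a) i (n + 1)
      omega
  have hup : ∀ i j n, w i j ∈ K → N < lidx (w i j) ∨ N < ridx (w i j) →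
      w (i + n) j ∈ K := by
    intro i j n h1 h2
    induction n with
    | zero => exact h1
    | succ n ih =>
      rw [← add_assoc, ← hl1]
      refine (hN _ ih (hw0 _ _) ?_).2.1
      rw [hlw, hrw] at h2 ⊢
      have := Nat.mul_add (ridx a) i n
      omega
  have hleft : ∀ i j n, w i (j + n) ∈ K → N < lidx (w i j) ∨ N < ridx (w i j) →
      w i j ∈ K := by
    intro i j n h1 h2
    induction n with
    | zero => exact h1
    | succ n ih =>
      refine ih ?_
      rw [← hr2]
      refine (hN _ h1 (hw0 _ _) ?_).2.2.2
      rw [hlw, hrw] at h2 ⊢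
      have := Nat.mul_add (ridx a) j (n + 1)
      omega
  -- The path goes around the box: first raise the second exponent to `n > N`, then lower the first
  -- to `0`.
  have hrow : ∀ n, j₀ + N < n → w 0 n ∈ K := fun n hn => by
    have h1 := hright i₀ j₀ (n - j₀) hxK hxN
    rw [Nat.add_sub_cancel' (by omega)] at h1
    refine hdown 0 n i₀ (by rwa [zero_add]) (Or.inr ?_)
    rw [hrw]
    have := hle n
    omega
  have hcol : ∀ n, i₀ + N < n → w n 0 ∈ K := fun n hn => by
    have h1 := hup i₀ j₀ (n - i₀) hxK hxN
    rw [Nat.add_sub_cancel' (by omega)] at h1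
    refine hleft n 0 j₀ (by rwa [zero_add]) (Or.inl ?_)
    rw [hlw]
    have := hle n
    omega
  have hrow0 : Tendsto (fun n => w 0 n) atTop (𝓝 0) := by
    refine tendsto_def.2 fun U hU => ?_
    obtain ⟨N', hN'⟩ := key U hU
    filter_upwards [eventually_gt_atTop (j₀ + N), eventually_gt_atTop N'] with n h1 h2
    refine hN' _ (hrow n h1) (hw0 _ _) (Or.inr ?_)
    rw [hrw]
    have := hle n
    omega
  have hcol0 : Tendsto (fun n => w n 0) atTop (𝓝 0) := by
    refine tendsto_def.2 fun U hU => ?_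
    obtain ⟨N', hN'⟩ := key U hU
    filter_upwards [eventually_gt_atTop (i₀ + N), eventually_gt_atTop N'] with n h1 h2
    refine hN' _ (hcol n h1) (hw0 _ _) (Or.inl ?_)
    rw [hlw]
    have := hle n
    omega
  have hprod : ∀ n, w 0 n * w n 0 = y * y := fun n => by
    calc w 0 n * w n 0 = y * (a ^ n * a⁻¹ ^ n) * y := by
          simp only [hw, pow_zero, one_mul, mul_one, mul_assoc]
      _ = y * y := by rw [pow_mul_inv_pow ha.ne_zero ha.lidx_eq, mul_one]
  have hlim := hrow0.mul hcol0
  simp only [hprod, mul_zero] at hlim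
  exact mul_ne_zero' hy hy (tendsto_nhds_unique tendsto_const_nhds hlim)

end OmegaFrame

end TopologicalOmega

/-! ### Transport along isomorphisms and embeddings. -/

section GreenTransport

theorem greenH_map_iff {A B : Type*} [Mul A] [Mul B] (f : A ≃* B) (x y : A) :
    GreenH (f x) (f y) ↔ GreenH x y := by
  have hl : ∀ z : A, f '' insert z (range fun s => s * z) =
      insert (f z) (range fun s => s * f z) := fun z => by
    rw [image_insert_eq, ← range_comp, ← f.surjective.range_comp]
    simp [Function.comp_def]
  have hr : ∀ z : A, f '' insert z (range fun s => z * s) =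
      insert (f z) (range fun s => f z * s) := fun z => by
    rw [image_insert_eq, ← range_comp, ← f.surjective.range_comp]
    simp [Function.comp_def]
  rw [GreenH, GreenH, ← hl, ← hl, ← hr, ← hr, f.injective.image_injective.eq_iff,
    f.injective.image_injective.eq_iff]

theorem greenHClass_eq_preimage {A B : Type*} [Mul A] [Mul B] (f : A ≃* B) (x : A) :
    greenHClass x = f ⁻¹' greenHClass (f x) :=
  ext fun y => (greenH_map_iff f x y).symm

end GreenTransport

namespace OmegaFrame

variable {S : Type u} [SemigroupWithZero S] [OmegaFrame S]

/-- Applied to `T`, `BR(T, θ)` and `BR⁰(T, θ)`. Continuity of inversion is asked only at points of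
the image, so the first two cases avoid `0`. -/
theorem isTopologicalInverseSemigroup_of_isEmbedding [TopologicalSpace S] [ContinuousMul S]
    {A : Type*} [Semigroup A] [TopologicalSpace A] (f : A →ₙ* S) (hf : IsEmbedding f)
    (hinv : ∀ x, ∃ y, f y = (f x)⁻¹) (hc : ∀ x, ContinuousAt (fun s : S => s⁻¹) (f x)) :
    IsTopologicalInverseSemigroup A := by
  choose g hg using hinv
  have hi : ∀ x, IsSemigroupInverse x (g x) := fun x =>
    ⟨hf.injective (by rw [map_mul, map_mul, hg, mul_inv_mul_self]),
      hf.injective (by rw [map_mul, map_mul, hg, inv_mul_inv_self])⟩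
  refine ⟨fun x => ⟨g x, hi x, fun y hy => hf.injective ?_⟩, hf.isInducing.continuousMul f,
    g, hi, ?_⟩
  · rw [hg]
    exact eq_inv ⟨by rw [← map_mul, ← map_mul, hy.1], by rw [← map_mul, ← map_mul, hy.2]⟩
  · rw [hf.isInducing.continuous_iff, continuous_iff_continuousAt]
    intro x
    have h : f ∘ g = (fun s : S => s⁻¹) ∘ f := funext hg
    rw [h]
    exact (hc x).comp hf.continuous.continuousAt

section HGroupTopology

variable [TopologicalSpace S]

instance (n : ℕ) : TopologicalSpace (HGroup S n) :=
  inferInstanceAs (TopologicalSpace {x : S // x ≠ 0 ∧ lidx x = n ∧ ridx x = n})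

theorem HGroup.isEmbedding_val (n : ℕ) : IsEmbedding (HGroup.val : HGroup S n → S) :=
  IsEmbedding.subtypeVal

instance (n : ℕ) [T2Space S] : T2Space (HGroup S n) :=
  (HGroup.isEmbedding_val n).t2Space

theorem HGroup.compactSpace (hc : ∀ H : Set S, IsMaximalSubgroupSet H → IsCompact H) (n : ℕ) :
    CompactSpace (HGroup S n) :=
  isCompact_iff_compactSpace.1 (hc _ (isMaximalSubgroupSet_idem n))

variable [T2Space S]

/-- The finite sum of compact groups is compact, and a continuous injection of a compact space into
a Hausdorff one is an embedding. -/
theorem isEmbedding_incl (hc : ∀ H : Set S, IsMaximalSubgroupSet H → IsCompact H) (d : ℕ) :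
    IsEmbedding (incl : (system S d).Total → S) := by
  have hG := HGroup.compactSpace hc
  have : CompactSpace (system S d).Total :=
    inferInstanceAs (CompactSpace (Σ α : (Fin d)ᵒᵈ, HGroup S (OrderDual.ofDual α).val))
  have hcont : Continuous (incl : (system S d).Total → S) :=
    continuous_sigma fun α => (HGroup.isEmbedding_val _).continuous
  exact (hcont.isClosedEmbedding incl_injective).isEmbedding

variable [ContinuousMul S]

theorem HGroup.isTopologicalGroup (hc : ∀ H : Set S, IsMaximalSubgroupSet H → IsCompact H)
    (n : ℕ) : IsTopologicalGroup (HGroup S n) where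
  toContinuousMul := (HGroup.isEmbedding_val n).isInducing.continuousMul
    (⟨HGroup.val, HGroup.val_mul⟩ : HGroup S n →ₙ* S)
  continuous_inv := by
    rw [(HGroup.isEmbedding_val n).isInducing.continuous_iff, continuous_iff_continuousAt]
    exact fun x => (continuousAt_inv_of_ne_zero hc x.ne_zero).comp
      (HGroup.isEmbedding_val n).continuous.continuousAt

variable {a : S} (ha : IsGenerator a) [NeZero (ridx a)]

theorem isTopologicalInverseSemigroup_bruckReilly
    (hc : ∀ H : Set S, IsMaximalSubgroupSet H → IsCompact H) :
    @IsTopologicalInverseSemigroup (BruckReilly (system S (ridx a)).Total (theta a ha)) _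
      (TopologicalSpace.induced (brHom ha) inferInstance) := by
  let _ : TopologicalSpace (BruckReilly (system S (ridx a)).Total (theta a ha)) :=
    TopologicalSpace.induced (brHom ha) inferInstance
  exact isTopologicalInverseSemigroup_of_isEmbedding (brHom ha) ⟨⟨rfl⟩, brHom_injective ha⟩
    (fun x => exists_brHom ha (inv_ne_zero' (brHom_ne_zero ha x)))
    (fun x => continuousAt_inv_of_ne_zero hc (brHom_ne_zero ha x))

end HGroupTopology

end OmegaFrame

open OmegaFrame in
theorem corollary3p16 {S : Type u} [SemigroupWithZero S] [TopologicalSpace S] [T2Space S]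
    [ContinuousMul S] (hS : IsZeroSimpleInverseOmegaSemigroup S)
    (hcomp : ∀ H : Set S, IsMaximalSubgroupSet H → IsCompact H) :
    ∃ (E : Type) (_ : SemilatticeInf E) (_ : OrderTop E) (_ : Finite E)
      (G : E → Type u) (_ : ∀ α, Group (G α)) (_ : ∀ α, TopologicalSpace (G α))
      (_ : ∀ α, IsTopologicalGroup (G α)) (_ : ∀ α, T2Space (G α))
      (_ : ∀ α, CompactSpace (G α))
      (Φ : SemilatticeGroupSystem E G) (θ : Φ.Total →* Φ.Totalˣ)
      (τ : TopologicalSpace (BruckReillyZero Φ.Total θ)),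
      Nonempty (S ≃ₜ* BruckReillyZero Φ.Total θ) ∧
      IsTopologicalInverseSemigroup Φ.Total ∧
      T2Space (BruckReillyZero Φ.Total θ) ∧
      ContinuousMul (BruckReillyZero Φ.Total θ) ∧
      ExtendsTopology θ τ ∧
      @IsTopologicalInverseSemigroup (BruckReilly Φ.Total θ) _
        (τ.induced ((↑) : BruckReilly Φ.Total θ → BruckReillyZero Φ.Total θ)) ∧
      (∀ x : BruckReillyZero Φ.Total θ, IsCompact (greenHClass x)) ∧
      (∀ x : BruckReillyZero Φ.Total θ, x ≠ 0 → IsOpen (greenHClass x)) ∧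
      (LocallyCompactSpace S →
        IsTopologicalInverseSemigroup (BruckReillyZero Φ.Total θ) ∧
        ∀ x : BruckReillyZero Φ.Total θ, IsOpen (greenHClass x)) := by

  obtain ⟨F⟩ := hS.nonempty_omegaFrame
  let _ := F
  obtain ⟨a, ha⟩ := exists_isGenerator hS.zeroSimple
  have := ha.neZero
  let e := brEquiv ha
  -- The topology is pulled back from `S`, so every topological claim is checked in `S`.
  let τ : TopologicalSpace (BruckReillyZero (system S (ridx a)).Total (theta a ha)) :=
    TopologicalSpace.induced e inferInstance
  let h : BruckReillyZero (system S (ridx a)).Total (theta a ha) ≃ₜ S :=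
    e.toEquiv.toHomeomorphOfIsInducing ⟨rfl⟩
  have hcl : ∀ x : S, IsCompact (greenHClass x) := fun x => by
    rcases eq_or_ne x 0 with rfl | hx
    · rw [greenHClass_zero]; exact isCompact_singleton
    · rw [greenHClass_eq hx]; exact isCompact_hClass hcomp _ _
  have hop : ∀ x : S, x ≠ 0 → IsOpen (greenHClass x) := fun x hx => by
    rw [greenHClass_eq hx]; exact isOpen_hClass hcomp _ _
  have hpre : ∀ x, greenHClass x = h ⁻¹' greenHClass (h x) := greenHClass_eq_preimage e
  have hne : ∀ x, x ≠ 0 → h x ≠ 0 := fun x hx h0 => hx (e.injective h0)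
  refine ⟨(Fin (ridx a))ᵒᵈ, inferInstance, inferInstance, inferInstance,
    fun α => HGroup S (OrderDual.ofDual α).val, inferInstance, inferInstance,
    fun α => HGroup.isTopologicalGroup hcomp _, inferInstance,
    fun α => HGroup.compactSpace hcomp _, system S (ridx a), theta a ha, τ,
    ⟨{ e.symm with
        continuous_toFun := h.symm.continuous
        continuous_invFun := h.continuous }⟩,
    isTopologicalInverseSemigroup_of_isEmbedding incl (isEmbedding_incl hcomp _)
      exists_incl_eq_inv (fun t => continuousAt_inv_of_ne_zero hcomp (incl_ne_zero t)),
    h.isEmbedding.t2Space, h.isInducing.continuousMul e, ⟨0, ?_⟩, ?_, fun x => ?_,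
    fun x hx => ?_, fun hloc => ⟨?_, fun x => ?_⟩⟩
  -- For `i = 0` the powers of `a` are trivial and the map becomes the inclusion of `T` in `S`.
  · rw [← h.isEmbedding.of_comp_iff]
    convert isEmbedding_incl hcomp (ridx a) using 1
    ext t
    change a⁻¹ ^ 0 * incl t * a ^ 0 = incl t
    simp
  · rw [induced_compose]
    exact isTopologicalInverseSemigroup_bruckReilly ha hcomp
  · rw [hpre]
    exact h.isCompact_preimage.2 (hcl _)
  · rw [hpre]
    exact (hop _ (hne x hx)).preimage h.continuous
  · refine isTopologicalInverseSemigroup_of_isEmbedding (e : _ →ₙ* S) h.isEmbedding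
      (fun x => e.surjective _) (fun x => ?_)
    rcases eq_or_ne (e x) 0 with hx | hx
    · change ContinuousAt _ (e x)
      rw [hx]
      -- At an isolated point every map is continuous.
      rw [ContinuousAt, (isOpen_singleton_iff_nhds_eq_pure _).1
        (isOpen_singleton_zero hS.zeroSimple hcomp)]
      exact (Filter.tendsto_pure_pure _ _).mono_right (pure_le_nhds _)
    · exact continuousAt_inv_of_ne_zero hcomp hx
  · rcases eq_or_ne x 0 with rfl | hx
    · rw [hpre]
      change IsOpen (h ⁻¹' greenHClass (0 : S))
      rw [greenHClass_zero]
      exact (isOpen_singleton_zero hS.zeroSimple hcomp).preimage h.continuous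
    · rw [hpre]
      exact (hop _ (hne x hx)).preimage h.continuous
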